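/- Let $R$ be a commutative noetherian ring, let $n\ge 0$, and let $R[[t]][x]=R[[t]][x_1,\dots,x_n]$ be the polynomial ring in $x_1,\dots,x_n$ over the power series ring $R[[t]]$. Let $I$ be an $x$-homogeneous ideal of $R[[t]][x]$, i.e. an ideal generated by elements that are homogeneous as polynomials in $x_1,\dots,x_n$ over $R[[t]]$. A $t$-local monomial ordering is a total ordering $>$ on the set of monomials $t^\beta x^\alpha$ ($\beta\in\mathbb{N}$, $\alpha\in\mathbb{N}^n$) that is compatible with multiplication and satisfies $1>t$. For such $>$ and $0\neq f=\sum_{\beta,\alpha}c_{\beta,\alpha}t^\beta x^\alpha\in R[[t]][x]$, the leading term $\mathrm{lt}_>(f)$ is $c_{\beta,\alpha}t^\beta x^\alpha$, where $t^\beta x^\alpha$ is the greatest monomial with respect to $>$ that occurs in $f$ with nonzero coefficient (it exists because $1>t$); set $\mathrm{lt}_>(0)=0$. The leading ideal of $I$ with respect to $>$ is the ideal $\mathrm{lt}_>(I)=\langle \mathrm{lt}_>(f)\mid f\in I\rangle$ of $R[t,x]=R[t,x_1,\dots,x_n]$. Then the set $$\{\,\mathrm{lt}_>(I)\;\mid\;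 >\text{ a $t$-local monomial ordering}\,\}$$ of ideals of $R[t,x]$ is finite. -/

import Mathlib

noncomputable section

/-- `R⟦t⟧[x₁, …, xₙ]`. -/
abbrev MixedRing (n : ℕ) (R : Type*) [CommRing R] : Type _ :=
  MvPolynomial (Fin n) (PowerSeries R)

/-- The (exponent vectors of) monomials in `t, x₁, …, xₙ`: the exponent of `t` is the entry at `0`,
and the exponent of `xᵢ` is the entry at `i`, for `i = 1, …, n`. Multiplication of monomials is
addition of exponent vectors. -/
abbrev Mon (n : ℕ) : Type := Fin (n + 1) →₀ ℕ

/-- A monomial ordering: a (strict) total ordering on the monomials in `t, x₁, …, xₙ` which is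
compatible with multiplication. It need not be a well-ordering. -/
structure MonomialOrdering (n : ℕ) where
  /-- `gt a b` means `a > b`. -/
  gt : Mon n → Mon n → Prop
  isStrictTotalOrder : IsStrictTotalOrder (Mon n) gt
  gt_add : ∀ a b c : Mon n, gt a b → gt (a + c) (b + c)

namespace MixedRing

variable {n : ℕ} {R : Type*} [CommRing R]

/-- The coefficient in `R` of `t ^ (m 0) * x ^ (m 1, …, m n)` in `f ∈ R⟦t⟧[x]`. -/
def monCoeff (m : Mon n) (f : MixedRing n R) : R :=
  PowerSeries.coeff (m 0) (MvPolynomial.coeff m.tail f)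

/-- An ideal of `R⟦t⟧[x]` is `x`-homogeneous if it is generated by elements that are homogeneous
as polynomials in `x` over `R⟦t⟧`. -/
def IsXHomogeneous (I : Ideal (MixedRing n R)) : Prop :=
  ∃ S : Set (MixedRing n R), (∀ f ∈ S, ∃ d : ℕ, MvPolynomial.IsHomogeneous f d) ∧ Ideal.span S = I

end MixedRing

namespace MonomialOrdering

variable {n : ℕ} {R : Type*} [CommRing R]

/-- `1 > t`. -/
def IsTLocal (o : MonomialOrdering n) : Prop :=
  o.gt 0 (Finsupp.single 0 1)

/-- `m` is the greatest monomial occurring in `f`. -/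
def IsLeadingMonomial (o : MonomialOrdering n) (f : MixedRing n R) (m : Mon n) : Prop :=
  MixedRing.monCoeff m f ≠ 0 ∧
    ∀ m' : Mon n, MixedRing.monCoeff m' f ≠ 0 → m' ≠ m → o.gt m m'

/-- For a `t`-local ordering every nonzero element has a leading monomial. -/
theorem exists_isLeadingMonomial (o : MonomialOrdering n) (ho : o.IsTLocal)
    {f : MixedRing n R} (hf : f ≠ 0) : ∃ m, o.IsLeadingMonomial f m := by
  classical
  have := o.isStrictTotalOrder
  have hstep : ∀ (k : ℕ) (a : Mon n), o.gt a (a + Finsupp.single 0 (k + 1)) := by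
    intro k a
    have h1 : ∀ b : Mon n, o.gt b (b + Finsupp.single 0 1) := fun b => by
      simpa [add_comm] using o.gt_add _ _ b ho
    induction k with
    | zero => exact h1 a
    | succ k ih =>
      refine _root_.trans ih ?_
      have := h1 (a + Finsupp.single 0 (k + 1))
      rwa [add_assoc, ← Finsupp.single_add] at this
  let c : (Fin n →₀ ℕ) → Mon n := fun α =>
    Finsupp.cons (PowerSeries.order (MvPolynomial.coeff α f)).toNat α
  obtain ⟨m, hm, hmax⟩ : ∃ m ∈ f.support.image c,
      ∀ m' ∈ f.support.image c, m' = m ∨ o.gt m m' :=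
    @Finset.exists_max_image _ _ (linearOrderOfSTO (fun a b => o.gt b a)) (f.support.image c) id
      ((MvPolynomial.support_nonempty.mpr hf).image c)
  obtain ⟨α, hα, rfl⟩ := Finset.mem_image.mp hm
  refine ⟨c α, ?_, ?_⟩
  · have h0 : MvPolynomial.coeff α f ≠ 0 := MvPolynomial.mem_support_iff.mp hα
    simpa [MixedRing.monCoeff, c] using PowerSeries.coeff_order h0
  · intro m' hm' hne
    have h0 : MvPolynomial.coeff m'.tail f ≠ 0 := by
      intro h; exact hm' (by simp [MixedRing.monCoeff, h])
    have hle : c m'.tail = c α ∨ o.gt (c α) (c m'.tail) :=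
      hmax _ (Finset.mem_image_of_mem c (MvPolynomial.mem_support_iff.mpr h0))
    have hord : (PowerSeries.order (MvPolynomial.coeff m'.tail f)).toNat ≤ m' 0 := by
      have := PowerSeries.order_le (m' 0) hm'
      exact ENat.toNat_le_of_le_natCast this
    obtain ⟨k, hk⟩ := Nat.exists_eq_add_of_le hord
    have hm'eq : m' = c m'.tail + Finsupp.single 0 k := by
      ext i
      refine Fin.cases ?_ (fun j => ?_) i
      · simp [c, hk.symm]
      · simp [c, Finsupp.tail_apply]
    rcases k with _ | k
    · have h : m' = c m'.tail := by simpa using hm'eq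
      rw [← h] at hle
      exact hle.resolve_left hne
    · have h := hstep k (c m'.tail)
      rw [← hm'eq] at h
      rcases hle with hle | hle
      · rwa [hle] at h
      · exact _root_.trans hle h

open Classical in
/-- The leading term `lt(f) ∈ R[t, x]`, with `lt(0) = 0`. -/
def leadingTerm (o : MonomialOrdering n) (f : MixedRing n R) : MvPolynomial (Fin (n + 1)) R :=
  if h : ∃ m, o.IsLeadingMonomial f m then
    MvPolynomial.monomial h.choose (MixedRing.monCoeff h.choose f)
  else 0

/-- The leading ideal: the ideal of `R[t, x]` generated by the leading terms of all elements
of `I`. -/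
def leadingIdeal (o : MonomialOrdering n) (I : Ideal (MixedRing n R)) :
    Ideal (MvPolynomial (Fin (n + 1)) R) :=
  Ideal.span (o.leadingTerm '' (I : Set (MixedRing n R)))

end MonomialOrdering

end

/-! Encoded by their comparison tables, the `t`-local orderings form a closed, hence compact, subset
of a Cantor space. The leading ideal is locally constant on it, so it takes finitely many values.

Local constancy: `R[t, x]` is noetherian, so finitely many leading terms generate the leading ideal
of `I` for `o`, and each is detected by finitely many comparisons. For `o'` near `o` this gives an
inclusion of leading ideals (`exists_finset_leadingIdeal_le`), and an inclusion is always an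
equality (`leadingIdeal_eq_of_le`).

The equality is a division argument (`leadingCoeffs_le_of_forall_le`). Homogeneity of `I` reduces it
to a fixed degree in `x`. If some `f` has an `o'`-leading coefficient that is not an `o`-leading
one, reduce the `o'`-tail of `f` by elements of `I` until no coefficient left there is an
`o`-leading coefficient at its monomial. The remainder is nonzero and lies in `I`, yet its own
`o`-leading coefficient must be one: a contradiction. The division is infinite; it converges
`t`-adically because the ideals of leading coefficients stabilize along powers of `t`. -/

noncomputable section

/-! ### Coefficients of monomials -/

namespace MixedRing

variable {n : ℕ} {R : Type*} [CommRing R]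

/-- The coefficient of a monomial, as an additive map. -/
def monCoeffHom (m : Mon n) : MixedRing n R →+ R :=
  (PowerSeries.coeff (R := R) (m 0)).toAddMonoidHom.comp
    (MvPolynomial.coeffAddMonoidHom m.tail)

theorem monCoeff_zero (m : Mon n) : monCoeff m (0 : MixedRing n R) = 0 :=
  (monCoeffHom (R := R) m).map_zero

theorem monCoeff_add (m : Mon n) (f g : MixedRing n R) :
    monCoeff m (f + g) = monCoeff m f + monCoeff m g := (monCoeffHom m).map_add f g

theorem monCoeff_sub (m : Mon n) (f g : MixedRing n R) :
    monCoeff m (f - g) = monCoeff m f - monCoeff m g := (monCoeffHom m).map_sub f g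

theorem monCoeff_sum {ι : Type*} (m : Mon n) (s : Finset ι) (f : ι → MixedRing n R) :
    monCoeff m (∑ i ∈ s, f i) = ∑ i ∈ s, monCoeff m (f i) := map_sum (monCoeffHom m) f s

theorem monCoeff_C_smul (m : Mon n) (a : R) (f : MixedRing n R) :
    monCoeff m (PowerSeries.C a • f) = a * monCoeff m f := by
  simp [monCoeff, MvPolynomial.coeff_smul]

theorem monCoeff_X_pow_smul_of_lt {m : Mon n} {k : ℕ} (h : m 0 < k) (f : MixedRing n R) :
    monCoeff m ((PowerSeries.X : PowerSeries R) ^ k • f) = 0 := by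
  simp [monCoeff, MvPolynomial.coeff_smul, PowerSeries.coeff_X_pow_mul', h]

/-- The monomial `t ^ (e 0) * x ^ (e 1, …, e n)` as an element of `R⟦t⟧[x]`. -/
def mon (R : Type*) [CommRing R] (e : Mon n) : MixedRing n R :=
  MvPolynomial.monomial e.tail (PowerSeries.X ^ e 0)

theorem tail_le_tail {e m : Mon n} (h : e ≤ m) : e.tail ≤ m.tail := fun i => h i.succ

theorem le_iff_zero_tail {e m : Mon n} : e ≤ m ↔ e 0 ≤ m 0 ∧ e.tail ≤ m.tail :=
  ⟨fun h => ⟨h 0, tail_le_tail h⟩, fun h i => Fin.cases h.1 (fun j => h.2 j) i⟩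

theorem tail_sub (m e : Mon n) : (m - e).tail = m.tail - e.tail := by
  ext i; simp [Finsupp.tail_apply]

theorem tail_add (m e : Mon n) : (m + e).tail = m.tail + e.tail := by
  ext i; simp [Finsupp.tail_apply]

theorem monCoeff_mon_mul (e m : Mon n) (f : MixedRing n R) :
    monCoeff m (mon R e * f) = if e ≤ m then monCoeff (m - e) f else 0 := by
  classical
  simp only [monCoeff, mon, MvPolynomial.coeff_monomial_mul', tail_sub, Finsupp.tsub_apply,
    le_iff_zero_tail (e := e)]
  by_cases h1 : e.tail ≤ m.tail <;> by_cases h0 : e 0 ≤ m 0 <;>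
    simp [h1, h0, PowerSeries.coeff_X_pow_mul']

theorem monCoeff_add_mon_mul (e m : Mon n) (f : MixedRing n R) :
    monCoeff (m + e) (mon R e * f) = monCoeff m f := by
  simp [monCoeff_mon_mul]

theorem tail_single_zero (k : ℕ) : (Finsupp.single 0 k : Mon n).tail = 0 := by
  ext i; simp [Finsupp.tail_apply]

theorem X_pow_smul_eq_mon_mul (k : ℕ) (f : MixedRing n R) :
    (PowerSeries.X : PowerSeries R) ^ k • f = mon R (Finsupp.single 0 k) * f := by
  rw [mon, tail_single_zero, MvPolynomial.smul_eq_C_mul]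
  simp

/-! ### Homogeneous parts and `t`-adic convergence -/

theorem mon_isHomogeneous (e : Mon n) : (mon R e).IsHomogeneous e.tail.degree :=
  MvPolynomial.isHomogeneous_monomial _ rfl

theorem degree_tail_of_monCoeff_ne_zero {f : MixedRing n R} {d : ℕ} (hf : f.IsHomogeneous d)
    {m : Mon n} (h : monCoeff m f ≠ 0) : m.tail.degree = d := by
  by_contra hd
  refine h ?_
  rw [monCoeff, hf.coeff_eq_zero (by simpa using hd), map_zero]

/-- The elements of an ideal that are homogeneous of degree `d` in `x`. -/
def homogeneousPart (I : Ideal (MixedRing n R)) (d : ℕ) :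
    Submodule (PowerSeries R) (MixedRing n R) :=
  I.restrictScalars (PowerSeries R) ⊓ MvPolynomial.homogeneousSubmodule (Fin n) (PowerSeries R) d

theorem IsXHomogeneous.homogeneousComponent_mem {I : Ideal (MixedRing n R)}
    (hI : IsXHomogeneous I) (d : ℕ) {f : MixedRing n R} (hf : f ∈ I) :
    MvPolynomial.homogeneousComponent d f ∈ homogeneousPart I d := by
  classical
  obtain ⟨S, hS, rfl⟩ := hI
  refine ⟨?_, MvPolynomial.homogeneousComponent_mem d f⟩
  let _ : GradedRing (MvPolynomial.homogeneousSubmodule (Fin n) (PowerSeries R)) :=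
    MvPolynomial.gradedAlgebra
  have h := Ideal.homogeneous_span
    (MvPolynomial.homogeneousSubmodule (Fin n) (PowerSeries R)) S hS d hf
  have h' := MvPolynomial.decomposition.decompose'_apply f d
  change _ ∈ Ideal.span S
  rw [← h']
  exact h

theorem monCoeff_homogeneousComponent (m : Mon n) (d : ℕ) (f : MixedRing n R) :
    monCoeff m (MvPolynomial.homogeneousComponent d f) =
      if m.tail.degree = d then monCoeff m f else 0 := by
  rw [monCoeff, MvPolynomial.coeff_homogeneousComponent]
  split_ifs <;> simp [monCoeff]

theorem finite_degree_eq (n d : ℕ) : {α : Fin n →₀ ℕ | α.degree = d}.Finite :=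
  (Finsupp.finite_of_degree_le d).subset fun _ hα => le_of_eq hα

/-- The finitely many monomials of degree `d` in `x` span the whole degree `d` part, and `R⟦t⟧` is
noetherian. -/
theorem fg_of_le_homogeneousSubmodule [IsNoetherianRing R] {d : ℕ}
    {N : Submodule (PowerSeries R) (MixedRing n R)}
    (hN : N ≤ MvPolynomial.homogeneousSubmodule (Fin n) (PowerSeries R) d) : N.FG := by
  classical
  have hfg : (MvPolynomial.homogeneousSubmodule (Fin n) (PowerSeries R) d).FG := by
    rw [Submodule.fg_def]
    refine ⟨(fun α => MvPolynomial.monomial α (1 : PowerSeries R)) '' {α | α.degree = d},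
      (finite_degree_eq n d).image _, le_antisymm ?_ ?_⟩
    · rw [Submodule.span_le]
      rintro _ ⟨α, hα, rfl⟩
      exact MvPolynomial.isHomogeneous_monomial _ hα
    · intro f hf
      rw [f.as_sum]
      refine Submodule.sum_mem _ fun α hα => ?_
      have h1 : MvPolynomial.monomial α (MvPolynomial.coeff α f) =
          MvPolynomial.coeff α f • MvPolynomial.monomial α (1 : PowerSeries R) := by
        simp [MvPolynomial.smul_monomial]
      rw [h1]
      refine Submodule.smul_mem _ _ (Submodule.subset_span ⟨α, ?_, rfl⟩)
      by_contra hd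
      exact MvPolynomial.mem_support_iff.mp hα
        (((MvPolynomial.mem_homogeneousSubmodule d f).mp hf).coeff_eq_zero hd)
  exact hfg.of_le hN

/-- A finitely generated `R⟦t⟧`-submodule is closed under infinite sums `∑ tⁱ uᵢ`. -/
theorem exists_infinite_sum {N : Submodule (PowerSeries R) (MixedRing n R)} (hN : N.FG)
    (u : ℕ → MixedRing n R) (hu : ∀ i, u i ∈ N) :
    ∃ S ∈ N, ∀ (m : Mon n) (k : ℕ), m 0 < k →
      monCoeff m S =
        ∑ i ∈ Finset.range k, monCoeff m ((PowerSeries.X : PowerSeries R) ^ i • u i) := by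
  obtain ⟨s, e, rfl⟩ := Submodule.fg_iff_exists_fin_generating_family.mp hN
  choose a ha using fun i => (Submodule.mem_span_range_iff_exists_fun (PowerSeries R)).mp (hu i)
  -- In terms of generators the claim is `t`-adic completeness of `R⟦t⟧`: only the summands with `i
  -- ≤ l` contribute to the coefficient of `t ^ l`.
  have hsum : ∀ b : ℕ → PowerSeries R, ∃ A : PowerSeries R, ∀ k, ∃ v,
      A = ∑ i ∈ Finset.range k, PowerSeries.X ^ i * b i + PowerSeries.X ^ k * v := by
    intro b
    refine ⟨PowerSeries.mk fun l => ∑ i ∈ Finset.range (l + 1),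
      PowerSeries.coeff l (PowerSeries.X ^ i * b i), fun k => ?_⟩
    suffices h : PowerSeries.X ^ k ∣ (PowerSeries.mk (fun l => ∑ i ∈ Finset.range (l + 1),
        PowerSeries.coeff l (PowerSeries.X ^ i * b i)) -
          ∑ i ∈ Finset.range k, PowerSeries.X ^ i * b i) by
      obtain ⟨v, hv⟩ := h
      exact ⟨v, by rw [← hv]; ring⟩
    rw [PowerSeries.X_pow_dvd_iff]
    intro l hl
    rw [map_sub, map_sum, PowerSeries.coeff_mk, sub_eq_zero]
    refine Finset.sum_subset (Finset.range_mono hl) fun i _ hi => ?_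
    rw [PowerSeries.coeff_X_pow_mul', if_neg]
    simpa [Nat.lt_succ_iff] using hi
  choose A hA using fun j => hsum fun i => a i j
  refine ⟨∑ j, A j • e j, Submodule.sum_mem _ fun j _ =>
    Submodule.smul_mem _ _ (Submodule.subset_span ⟨j, rfl⟩), fun m k hk => ?_⟩
  choose v hv using fun j => hA j k
  have : ∑ j, A j • e j = ∑ i ∈ Finset.range k, (PowerSeries.X : PowerSeries R) ^ i • u i +
      (PowerSeries.X : PowerSeries R) ^ k • ∑ j, v j • e j := by
    simp_rw [← ha, Finset.smul_sum]
    rw [Finset.sum_comm, ← Finset.sum_add_distrib]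
    refine Finset.sum_congr rfl fun j _ => ?_
    rw [hv j, add_smul, Finset.sum_smul]
    simp [mul_smul]
  rw [this, monCoeff_add, monCoeff_X_pow_smul_of_lt hk, add_zero, monCoeff_sum]

end MixedRing

/-! ### Ideals of leading coefficients -/

namespace MonomialOrdering

open MixedRing

variable {n : ℕ} {R : Type*} [CommRing R] (o : MonomialOrdering n)

theorem gt_trans {a b c : Mon n} (h : o.gt a b) (h' : o.gt b c) : o.gt a c :=
  have := o.isStrictTotalOrder
  _root_.trans h h'

theorem gt_irrefl (a : Mon n) : ¬ o.gt a a :=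
  have := o.isStrictTotalOrder
  irrefl a

theorem gt_asymm {a b : Mon n} (h : o.gt a b) : ¬ o.gt b a :=
  fun h' => o.gt_irrefl _ (o.gt_trans h h')

theorem gt_trichotomy (a b : Mon n) : o.gt a b ∨ a = b ∨ o.gt b a :=
  have := o.isStrictTotalOrder
  trichotomous_of o.gt a b

/-- Every monomial occurring in `f` is at most `m`. -/
def IsBoundedBy (f : MixedRing n R) (m : Mon n) : Prop :=
  ∀ m' : Mon n, monCoeff m' f ≠ 0 → m' = m ∨ o.gt m m'

variable {o}

theorem IsBoundedBy.add {f g : MixedRing n R} {m : Mon n} (hf : o.IsBoundedBy f m)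
    (hg : o.IsBoundedBy g m) : o.IsBoundedBy (f + g) m := by
  intro m' h
  by_cases hf' : monCoeff m' f = 0
  · exact hg m' fun hg' => h (by rw [monCoeff_add, hf', hg', add_zero])
  · exact hf m' hf'

theorem IsBoundedBy.C_smul {f : MixedRing n R} {m : Mon n} (a : R) (hf : o.IsBoundedBy f m) :
    o.IsBoundedBy (PowerSeries.C a • f) m :=
  fun m' h => hf m' fun h0 => h (by rw [monCoeff_C_smul, h0, mul_zero])

theorem IsBoundedBy.mon_mul {f : MixedRing n R} {m : Mon n} (e : Mon n)
    (hf : o.IsBoundedBy f m) : o.IsBoundedBy (mon R e * f) (m + e) := by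
  intro m' h
  rw [monCoeff_mon_mul] at h
  split_ifs at h with he
  · obtain ⟨p, rfl⟩ := exists_add_of_le he
    rw [add_tsub_cancel_left] at h
    rw [add_comm e p]
    exact (hf p h).imp (fun h => by rw [h]) (o.gt_add _ _ e)
  · exact absurd rfl h

theorem IsLeadingMonomial.isBoundedBy {f : MixedRing n R} {m : Mon n}
    (h : o.IsLeadingMonomial f m) : o.IsBoundedBy f m :=
  fun m' hm' => or_iff_not_imp_left.mpr (h.2 m' hm')

variable (o)

/-- The coefficients at `m` of those elements of `N` all of whose monomials are at most `m`. -/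
def leadingCoeffs (N : Submodule (PowerSeries R) (MixedRing n R)) (m : Mon n) : Ideal R where
  carrier := {c | ∃ h ∈ N, o.IsBoundedBy h m ∧ monCoeff m h = c}
  zero_mem' := ⟨0, N.zero_mem, fun m' h => absurd (monCoeff_zero m') h, monCoeff_zero m⟩
  add_mem' := by
    rintro _ _ ⟨h, hN, hb, rfl⟩ ⟨h', hN', hb', rfl⟩
    exact ⟨h + h', N.add_mem hN hN', hb.add hb', monCoeff_add m h h'⟩
  smul_mem' := by
    rintro a _ ⟨h, hN, hb, rfl⟩
    exact ⟨PowerSeries.C a • h, N.smul_mem _ hN, hb.C_smul a, monCoeff_C_smul m a h⟩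

theorem leadingCoeffs_le_add_single (N : Submodule (PowerSeries R) (MixedRing n R)) (m : Mon n)
    (k : ℕ) : o.leadingCoeffs N m ≤ o.leadingCoeffs N (m + Finsupp.single 0 k) := by
  rintro _ ⟨h, hN, hb, rfl⟩
  refine ⟨mon R (Finsupp.single 0 k) * h, ?_, hb.mon_mul _, monCoeff_add_mon_mul _ _ _⟩
  rw [← X_pow_smul_eq_mon_mul]
  exact N.smul_mem _ hN

theorem leadingCoeffs_homogeneousPart_le_add (I : Ideal (MixedRing n R)) (m e : Mon n) :
    o.leadingCoeffs (homogeneousPart I m.tail.degree) m ≤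
      o.leadingCoeffs (homogeneousPart I (m + e).tail.degree) (m + e) := by
  rintro _ ⟨h, hN, hb, rfl⟩
  refine ⟨mon R e * h, ⟨I.mul_mem_left _ hN.1, ?_⟩, hb.mon_mul _, monCoeff_add_mon_mul _ _ _⟩
  have := (mon_isHomogeneous (R := R) e).mul hN.2
  rwa [add_comm, ← map_add, ← tail_add] at this

variable {o}

/-- Finitely many exponents in `x` have degree `d`, so `s` is the set of monomials of an element of
`ℤ⟦t⟧[x]`, which has a leading monomial. -/
theorem IsTLocal.exists_greatest (ho : o.IsTLocal) {d : ℕ} {s : Set (Mon n)} (hs : s.Nonempty)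
    (hd : ∀ m ∈ s, m.tail.degree = d) : ∃ m ∈ s, ∀ m' ∈ s, m' ≠ m → o.gt m m' := by
  classical
  let f : MixedRing n ℤ := ∑ α ∈ (finite_degree_eq n d).toFinset,
    MvPolynomial.monomial α (PowerSeries.mk fun β => if Finsupp.cons β α ∈ s then 1 else 0)
  have hf : ∀ m, monCoeff m f ≠ 0 ↔ m ∈ s := by
    intro m
    have : monCoeff m f = if m.tail.degree = d then (if m ∈ s then 1 else 0) else 0 := by
      simp [f, monCoeff, MvPolynomial.coeff_sum, MvPolynomial.coeff_monomial]
      split_ifs <;> simp_all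
    by_cases hm : m ∈ s
    · simp [this, hm, hd m hm]
    · simp [this, hm]
  obtain ⟨m₀, hm₀⟩ := hs
  have hf0 : f ≠ 0 := fun h => (hf m₀).mpr hm₀ (by rw [h, monCoeff_zero])
  obtain ⟨m, hm, hmax⟩ := o.exists_isLeadingMonomial ho hf0
  exact ⟨m, (hf m).mp hm, fun m' hm' => hmax m' ((hf m').mpr hm')⟩

/-- This allows recursion downwards from the greatest monomial, as division requires. -/
theorem IsTLocal.wellFounded (ho : o.IsTLocal) (d : ℕ) :
    WellFounded fun m' m : Mon n => m'.tail.degree = d ∧ o.gt m' m := by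
  rw [WellFounded.wellFounded_iff_has_min]
  intro s hs
  by_cases h : {m ∈ s | m.tail.degree = d}.Nonempty
  · obtain ⟨m, hm, hmax⟩ := ho.exists_greatest h fun m hm => hm.2
    refine ⟨m, hm.1, fun m' hm' hgt => ?_⟩
    by_cases hne : m' = m
    · exact o.gt_irrefl m (hne ▸ hgt.2)
    · exact o.gt_asymm (hmax m' ⟨hm', hgt.1⟩ hne) hgt.2
  · obtain ⟨m, hm⟩ := hs
    exact ⟨m, hm, fun m' hm' hgt => h ⟨m', hm', hgt.1⟩⟩

variable (o)

/-- For fixed `α` the ideals ascend with the power of `t`, hence stabilize; `C` is the maximum over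
the finitely many `α`. -/
theorem exists_leadingCoeffs_stable [IsNoetherianRing R]
    (N : Submodule (PowerSeries R) (MixedRing n R)) (d : ℕ) :
    ∃ C : ℕ, ∀ α : Fin n →₀ ℕ, α.degree = d → ∀ β, C ≤ β →
      o.leadingCoeffs N (Finsupp.cons β α) ≤ o.leadingCoeffs N (Finsupp.cons C α) := by
  have hmono : ∀ α : Fin n →₀ ℕ, Monotone fun β => o.leadingCoeffs N (Finsupp.cons β α) := by
    intro α β β' h
    obtain ⟨k, rfl⟩ := Nat.exists_eq_add_of_le h
    have : Finsupp.cons (β + k) α = Finsupp.cons β α + Finsupp.single 0 k := by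
      ext i
      refine Fin.cases ?_ (fun j => ?_) i <;> simp
    simpa [this] using o.leadingCoeffs_le_add_single N (Finsupp.cons β α) k
  choose B hB using fun α => monotone_stabilizes_iff_noetherian.mpr
    (inferInstanceAs (IsNoetherian R R)) ⟨_, hmono α⟩
  refine ⟨(finite_degree_eq n d).toFinset.sup B, fun α hα β hβ => ?_⟩
  have hle : B α ≤ (finite_degree_eq n d).toFinset.sup B :=
    Finset.le_sup (f := B) ((finite_degree_eq n d).mem_toFinset.mpr hα)
  have h1 := hB α β (hle.trans hβ)
  have h2 := hB α _ hle
  exact (h1.symm.trans h2).le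

/-! ### Infinite division and the absence of proper inclusions -/

variable {o} {o' : MonomialOrdering n}

/-- If `a` is an `o`-leading coefficient, it is the leading coefficient for `o'` of an element
whose divisibility by `t` grows with the exponent of `t` in the monomial. -/
theorem exists_isBoundedBy_X_pow_smul {N : Submodule (PowerSeries R) (MixedRing n R)} {d C : ℕ}
    (hle : ∀ m, o.leadingCoeffs N m ≤ o'.leadingCoeffs N m)
    (hC : ∀ α : Fin n →₀ ℕ, α.degree = d → ∀ β, C ≤ β →
      o.leadingCoeffs N (Finsupp.cons β α) ≤ o.leadingCoeffs N (Finsupp.cons C α))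
    {m : Mon n} (hm : m.tail.degree = d) {a : R} (ha : a ∈ o.leadingCoeffs N m) :
    ∃ w ∈ N, o'.IsBoundedBy ((PowerSeries.X : PowerSeries R) ^ (m 0 - C) • w) m ∧
      monCoeff m ((PowerSeries.X : PowerSeries R) ^ (m 0 - C) • w) = a := by
  rcases le_total (m 0) C with h | h
  · obtain ⟨w, hw, hb, hc⟩ := hle m ha
    exact ⟨w, hw, by simpa [Nat.sub_eq_zero_of_le h] using hb,
      by simpa [Nat.sub_eq_zero_of_le h] using hc⟩
  · obtain ⟨k, hk⟩ := Nat.exists_eq_add_of_le h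
    have hmk : m = Finsupp.cons C m.tail + Finsupp.single 0 k := by
      ext i
      refine Fin.cases ?_ (fun j => ?_) i <;> simp [hk, Finsupp.tail_apply]
    -- By stability `a` already occurs at `t`-exponent `C`. The inclusion `hle` is applied there,
    -- and the resulting element is multiplied by `t ^ k`.
    have ha' : a ∈ o.leadingCoeffs N (Finsupp.cons C m.tail) :=
      hC m.tail hm (m 0) h (by rwa [Finsupp.cons_tail])
    obtain ⟨w, hw, hb, hc⟩ := hle _ ha'
    have hsub : m 0 - C = k := by omega
    refine ⟨w, hw, ?_⟩
    rw [hsub, X_pow_smul_eq_mon_mul]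
    constructor
    · rw [hmk]; exact hb.mon_mul _
    · rw [hmk, monCoeff_add_mon_mul]; exact hc

/-- The monomials of degree `d` in `x` with exponent of `t` less than `k`. -/
def box (n d k : ℕ) : Finset (Mon n) :=
  ((finite_degree_eq n d).toFinset ×ˢ Finset.range k).image fun p => Finsupp.cons p.2 p.1

theorem mem_box {d k : ℕ} {m : Mon n} : m ∈ box n d k ↔ m.tail.degree = d ∧ m 0 < k := by
  simp only [box, Finset.mem_image, Finset.mem_product, Set.Finite.mem_toFinset, Finset.mem_range,
    Set.mem_ofPred_eq,
    Prod.exists]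
  constructor
  · rintro ⟨α, β, ⟨h1, h2⟩, rfl⟩
    exact ⟨by simpa using h1, by simpa using h2⟩
  · rintro ⟨h1, h2⟩
    exact ⟨m.tail, m 0, ⟨h1, h2⟩, Finsupp.cons_tail m⟩

/-- Infinite sums over the monomials of degree `d` in `x` converge inside a finitely generated
submodule, provided that the summands get divisible by increasing powers of `t`. -/
theorem exists_sum_over_monomials {N : Submodule (PowerSeries R) (MixedRing n R)} (hN : N.FG)
    (d C : ℕ) (U : Mon n → MixedRing n R) (hU : ∀ m, U m ∈ N) :
    ∃ S ∈ N, ∀ m : Mon n, monCoeff m S =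
      ∑ p ∈ box n d (C + (m 0 + 1)),
        monCoeff m ((PowerSeries.X : PowerSeries R) ^ (p 0 - C) • U p) := by
  classical
  set A := (finite_degree_eq n d).toFinset
  let V : ℕ → MixedRing n R := fun β => ∑ α ∈ A, U (Finsupp.cons β α)
  have hV : ∀ β, V β ∈ N := fun β => Submodule.sum_mem _ fun α _ => hU _
  -- The layers below `C` carry no factor of `t`; layer `C + i` carries `t ^ i` and reaches `m` only
  -- if `i ≤ m 0`, whence the size of the box.
  obtain ⟨S, hS, hSc⟩ := exists_infinite_sum hN (fun i => V (C + i)) fun i => hV _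
  refine ⟨∑ β ∈ Finset.range C, V β + S,
    N.add_mem (Submodule.sum_mem _ fun β _ => hV β) hS, fun m => ?_⟩
  have hbox : ∀ g : Mon n → R, ∑ p ∈ box n d (C + (m 0 + 1)), g p =
      ∑ β ∈ Finset.range (C + (m 0 + 1)), ∑ α ∈ A, g (Finsupp.cons β α) := by
    intro g
    rw [box, Finset.sum_image, Finset.sum_product_right]
    rintro ⟨α, β⟩ - ⟨α', β'⟩ - h
    have h0 := congrArg (fun q : Mon n => q 0) h
    have h1 := congrArg Finsupp.tail h
    simp only [Finsupp.cons_zero, Finsupp.tail_cons] at h0 h1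
    rw [h0, h1]
  rw [hbox, Finset.sum_range_add, monCoeff_add, hSc m (m 0 + 1) (Nat.lt_succ_self _),
    monCoeff_sum]
  refine congrArg₂ (· + ·) (Finset.sum_congr rfl fun β hβ => ?_)
    (Finset.sum_congr rfl fun i _ => ?_)
  · have : β - C = 0 := Nat.sub_eq_zero_of_le (Finset.mem_range.mp hβ).le
    simp [V, monCoeff_sum, this]
  · simp [V, monCoeff_sum, Finset.smul_sum]

/-- If every `o`-leading coefficient is an `o'`-leading coefficient, then the converse holds. -/
theorem leadingCoeffs_le_of_forall_le [IsNoetherianRing R] (ho : o.IsTLocal) (ho' : o'.IsTLocal)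
    {N : Submodule (PowerSeries R) (MixedRing n R)} {d : ℕ}
    (hN : N ≤ MvPolynomial.homogeneousSubmodule (Fin n) (PowerSeries R) d)
    (hle : ∀ m, o.leadingCoeffs N m ≤ o'.leadingCoeffs N m) (m₀ : Mon n) :
    o'.leadingCoeffs N m₀ ≤ o.leadingCoeffs N m₀ := by
  classical
  rintro c ⟨f, hfN, hfb, hfc⟩
  by_contra hcJ
  obtain ⟨C, hC⟩ := o.exists_leadingCoeffs_stable N d
  -- The reducer at `m` for the coefficient `a`. It is zero unless `m` is `o'`-below `m₀`, which
  -- protects the coefficient `c` at `m₀`, and `a` is an `o`-leading coefficient.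
  have hw : ∀ (m : Mon n) (a : R), ∃ w ∈ N,
      o'.IsBoundedBy ((PowerSeries.X : PowerSeries R) ^ (m 0 - C) • w) m ∧
      (m.tail.degree = d → o'.gt m₀ m → a ∈ o.leadingCoeffs N m →
        monCoeff m ((PowerSeries.X : PowerSeries R) ^ (m 0 - C) • w) = a) ∧
      (¬ (o'.gt m₀ m ∧ a ∈ o.leadingCoeffs N m) → w = 0) := by
    intro m a
    by_cases h : m.tail.degree = d ∧ o'.gt m₀ m ∧ a ∈ o.leadingCoeffs N m
    · obtain ⟨w, hwN, hb, hc⟩ := exists_isBoundedBy_X_pow_smul hle hC h.1 h.2.2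
      exact ⟨w, hwN, hb, fun _ _ _ => hc, fun h' => absurd h.2 h'⟩
    · refine ⟨0, N.zero_mem, fun m' h' => absurd ?_ h', fun h1 h2 h3 => absurd ⟨h1, h2, h3⟩ h,
        fun _ => rfl⟩
      rw [smul_zero, monCoeff_zero]
  choose w hwN hwb hwc hw0 using hw
  -- `U m` is the element subtracted at `m` when dividing `f`, going down from the greatest monomial
  let T : Mon n → MixedRing n R → MixedRing n R :=
    fun p u => (PowerSeries.X : PowerSeries R) ^ (p 0 - C) • u
  obtain ⟨U, a, hUa, ha⟩ : ∃ (U : Mon n → MixedRing n R) (a : Mon n → R),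
      (∀ m, U m = w m (a m)) ∧ ∀ m, a m = monCoeff m f -
        ∑ p ∈ box n d (C + (m 0 + 1)), if o'.gt p m then monCoeff m (T p (U p)) else 0 := by
    let F : (m : Mon n) → ((p : Mon n) → (p.tail.degree = d ∧ o'.gt p m) → MixedRing n R) →
        MixedRing n R := fun m ih => w m (monCoeff m f -
      ∑ p ∈ box n d (C + (m 0 + 1)),
        if h : p.tail.degree = d ∧ o'.gt p m then monCoeff m (T p (ih p h)) else 0)
    refine ⟨(ho'.wellFounded d).fix F, _, fun m => ?_, fun m => rfl⟩
    rw [WellFounded.fix_eq]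
    refine congrArg (fun s => w m (monCoeff m f - s)) (Finset.sum_congr rfl fun p hp => ?_)
    simp [(mem_box.mp hp).1]
  have hUN : ∀ m, U m ∈ N := fun m => hUa m ▸ hwN _ _
  obtain ⟨S, hSN, hS⟩ := exists_sum_over_monomials (fg_of_le_homogeneousSubmodule hN) d C U hUN
  -- Elements subtracted at `p` are `o'`-bounded by `p`, so only those with `p` at or above `m`
  -- affect the coefficient at `m`.
  have hr : ∀ m : Mon n, m.tail.degree = d →
      monCoeff m (f - S) = a m - monCoeff m (T m (U m)) := by
    intro m hm
    have hmbox : m ∈ box n d (C + (m 0 + 1)) := mem_box.mpr ⟨hm, by omega⟩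
    have hsplit : monCoeff m S =
        ∑ p ∈ box n d (C + (m 0 + 1)), ((if o'.gt p m then monCoeff m (T p (U p)) else 0) +
          if p = m then monCoeff m (T p (U p)) else 0) := by
      rw [hS]
      refine Finset.sum_congr rfl fun p _ => ?_
      rcases o'.gt_trichotomy p m with h | h | h
      · have : p ≠ m := fun h' => o'.gt_irrefl m (h' ▸ h)
        simp [h, this, T]
      · subst h
        simp [o'.gt_irrefl, T]
      · have hne : p ≠ m := fun h' => o'.gt_irrefl m (h' ▸ h)
        rw [if_neg (o'.gt_asymm h), if_neg hne, add_zero]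
        by_contra h0
        rw [hUa p] at h0
        rcases hwb p (a p) m h0 with h' | h'
        · exact hne h'.symm
        · exact o'.gt_asymm h h'
    rw [monCoeff_sub, hsplit, Finset.sum_add_distrib, Finset.sum_ite_eq', if_pos hmbox, ha]
    ring
  have hU0 : ∀ m, ¬ o'.gt m₀ m → U m = 0 := fun m h => by
    rw [hUa]; exact hw0 _ _ fun h' => h h'.1
  have hT0 : ∀ p m, monCoeff m (T p 0) = 0 := fun p m => by
    simp only [T, smul_zero, monCoeff_zero]
  have hrtop : ∀ m : Mon n, m.tail.degree = d → ¬ o'.gt m₀ m →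
      monCoeff m (f - S) = monCoeff m f := by
    intro m hm h
    rw [hr m hm, hU0 m h, hT0, sub_zero, ha, Finset.sum_eq_zero, sub_zero]
    intro p _
    split_ifs with hp
    · rw [hU0 p, hT0]
      exact fun hp' => h (o'.gt_trans hp' hp)
    · rfl
  have hc0 : c ≠ 0 := fun h => hcJ (h ▸ Ideal.zero_mem _)
  have hm₀ : m₀.tail.degree = d := degree_tail_of_monCoeff_ne_zero (hN hfN) (hfc.symm ▸ hc0)
  have hrm₀ : monCoeff m₀ (f - S) = c := by rw [hrtop m₀ hm₀ (o'.gt_irrefl m₀), hfc]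
  have hr0 : f - S ≠ 0 := fun h => hc0 (by rw [← hrm₀, h, monCoeff_zero])
  have hrN : f - S ∈ N := N.sub_mem hfN hSN
  -- At the `o`-leading monomial `m` of the remainder, the coefficient is a nonzero `o`-leading
  -- coefficient. But below `m₀` (for `o'`) coefficients were either cancelled or not `o`-leading,
  -- at `m₀` stands `c`, and above `m₀` there is nothing.
  obtain ⟨m, hm⟩ := o.exists_isLeadingMonomial ho hr0
  have hmd : m.tail.degree = d := degree_tail_of_monCoeff_ne_zero (hN hrN) hm.1
  have hmJ : monCoeff m (f - S) ∈ o.leadingCoeffs N m := ⟨_, hrN, hm.isBoundedBy, rfl⟩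
  by_cases hgt : o'.gt m₀ m
  · by_cases haJ : a m ∈ o.leadingCoeffs N m
    · refine hm.1 ?_
      rw [hr m hmd, hUa, hwc m (a m) hmd hgt haJ, sub_self]
    · have h0 : U m = 0 := by rw [hUa]; exact hw0 _ _ fun h' => haJ h'.2
      rw [hr m hmd, h0, hT0, sub_zero] at hmJ
      exact haJ hmJ
  · have hm1 := hm.1
    rw [hrtop m hmd hgt] at hm1
    rcases hfb m hm1 with h | h
    · subst h
      exact hcJ (hrm₀ ▸ hmJ)
    · exact hgt h

/-! ### Leading ideals through leading coefficients -/

theorem IsLeadingMonomial.unique {f : MixedRing n R} {m m' : Mon n}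
    (h : o.IsLeadingMonomial f m) (h' : o.IsLeadingMonomial f m') : m = m' := by
  by_contra hne
  exact o.gt_asymm (h.2 m' h'.1 (Ne.symm hne)) (h'.2 m h.1 hne)

theorem IsLeadingMonomial.leadingTerm_eq {f : MixedRing n R} {m : Mon n}
    (h : o.IsLeadingMonomial f m) :
    o.leadingTerm f = MvPolynomial.monomial m (monCoeff m f) := by
  have hex : ∃ m, o.IsLeadingMonomial f m := ⟨m, h⟩
  rw [leadingTerm, dif_pos hex, hex.choose_spec.unique h]

theorem leadingTerm_zero (o : MonomialOrdering n) : o.leadingTerm (0 : MixedRing n R) = 0 := by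
  rw [leadingTerm, dif_neg]
  rintro ⟨m, hm⟩
  exact hm.1 (monCoeff_zero m)

/-- A leading term of `f ∈ I` is also that of a homogeneous component of `f`, again in `I`, and
multiplying by monomials preserves the claim. Together with `monomial_mem_leadingIdeal`, this makes
leading ideals comparable degree by degree. -/
theorem coeff_mem_leadingCoeffs (ho : o.IsTLocal) {I : Ideal (MixedRing n R)}
    (hI : IsXHomogeneous I) {p : MvPolynomial (Fin (n + 1)) R} (hp : p ∈ o.leadingIdeal I)
    (m : Mon n) :
    MvPolynomial.coeff m p ∈ o.leadingCoeffs (homogeneousPart I m.tail.degree) m := by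
  classical
  revert m
  refine Submodule.span_induction ?_ ?_ ?_ ?_ hp
  · rintro _ ⟨f, hf, rfl⟩ m
    by_cases hf0 : f = 0
    · rw [hf0, leadingTerm_zero, MvPolynomial.coeff_zero]
      exact Ideal.zero_mem _
    obtain ⟨l, hl⟩ := o.exists_isLeadingMonomial ho hf0
    rw [hl.leadingTerm_eq, MvPolynomial.coeff_monomial]
    split_ifs with h
    · subst h
      refine ⟨_, hI.homogeneousComponent_mem l.tail.degree hf, fun m' hm' => ?_, ?_⟩
      · rw [monCoeff_homogeneousComponent] at hm'
        split_ifs at hm' with h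
        · exact hl.isBoundedBy m' hm'
        · exact absurd rfl hm'
      · rw [monCoeff_homogeneousComponent, if_pos rfl]
    · exact Ideal.zero_mem _
  · intro m
    rw [MvPolynomial.coeff_zero]
    exact Ideal.zero_mem _
  · intro p q _ _ hp hq m
    rw [MvPolynomial.coeff_add]
    exact Ideal.add_mem _ (hp m) (hq m)
  · intro q p _ hp m
    rw [smul_eq_mul, MvPolynomial.coeff_mul]
    refine Ideal.sum_mem _ fun x hx => Ideal.mul_mem_left _ _ ?_
    rw [← Finset.HasAntidiagonal.mem_antidiagonal.mp hx, add_comm]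
    exact o.leadingCoeffs_homogeneousPart_le_add I x.2 x.1 (hp x.2)

theorem monomial_mem_leadingIdeal {I : Ideal (MixedRing n R)} {d : ℕ} {m : Mon n} {c : R}
    (hc : c ∈ o.leadingCoeffs (homogeneousPart I d) m) :
    MvPolynomial.monomial m c ∈ o.leadingIdeal I := by
  obtain ⟨h, hN, hb, rfl⟩ := hc
  by_cases h0 : monCoeff m h = 0
  · rw [h0, map_zero]
    exact Ideal.zero_mem _
  · have hl : o.IsLeadingMonomial h m := ⟨h0, fun m' hm' hne => (hb m' hm').resolve_left hne⟩
    rw [← hl.leadingTerm_eq]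
    exact Ideal.subset_span ⟨h, hN.1, rfl⟩

/-- There are no proper inclusions between leading ideals. -/
theorem leadingIdeal_eq_of_le [IsNoetherianRing R] (ho : o.IsTLocal) (ho' : o'.IsTLocal)
    {I : Ideal (MixedRing n R)} (hI : IsXHomogeneous I)
    (hle : o.leadingIdeal I ≤ o'.leadingIdeal I) : o'.leadingIdeal I = o.leadingIdeal I := by
  classical
  refine le_antisymm (fun p hp => ?_) hle
  rw [p.as_sum]
  refine Ideal.sum_mem _ fun m _ => ?_
  refine monomial_mem_leadingIdeal (d := m.tail.degree)
    (leadingCoeffs_le_of_forall_le ho ho' inf_le_right ?_ m (coeff_mem_leadingCoeffs ho' hI hp m))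
  intro l c hc
  by_cases hl : c = 0
  · rw [hl]; exact Ideal.zero_mem _
  -- A nonzero coefficient forces `l` into the degree considered, so both homogeneous parts are the
  -- same.
  have hdeg : l.tail.degree = m.tail.degree := by
    obtain ⟨h, hN, -, rfl⟩ := hc
    exact degree_tail_of_monCoeff_ne_zero hN.2 hl
  have := coeff_mem_leadingCoeffs ho' hI (hle (monomial_mem_leadingIdeal hc)) l
  rwa [MvPolynomial.coeff_monomial, if_pos rfl, hdeg] at this

/-! ### Dependence on finitely many comparisons -/

theorem IsTLocal.gt_add_single (ho : o.IsTLocal) (a : Mon n) (k : ℕ) :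
    a + Finsupp.single 0 k = a ∨ o.gt a (a + Finsupp.single 0 k) := by
  induction k with
  | zero => left; simp
  | succ k ih =>
    right
    have h : o.gt (a + Finsupp.single 0 k) (a + Finsupp.single 0 (k + 1)) := by
      have := o.gt_add _ _ (a + Finsupp.single 0 k) ho
      rwa [zero_add, add_comm (Finsupp.single 0 1), add_assoc, ← Finsupp.single_add] at this
    rcases ih with ih | ih
    · rwa [ih] at h
    · exact o.gt_trans ih h

/-- Whether `m` is the leading monomial of `f` depends on finitely many comparisons only. -/
theorem exists_finset_isLeadingMonomial {f : MixedRing n R} {m : Mon n}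
    (h : o.IsLeadingMonomial f m) :
    ∃ s : Finset (Mon n), (∀ p ∈ s, o.gt m p) ∧
      ∀ o' : MonomialOrdering n, o'.IsTLocal → (∀ p ∈ s, o'.gt m p) →
        o'.IsLeadingMonomial f m := by
  classical
  -- For each `α` in the support, the lowest power of `t` dominates all others in every `t`-local
  -- ordering, so one comparison per `α` suffices.
  let c : (Fin n →₀ ℕ) → Mon n := fun α =>
    Finsupp.cons (PowerSeries.order (MvPolynomial.coeff α f)).toNat α
  refine ⟨(f.support.image c).erase m, fun p hp => ?_, fun o' ho' hs => ⟨h.1, fun p hp hne => ?_⟩⟩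
  · obtain ⟨hne, hp⟩ := Finset.mem_erase.mp hp
    obtain ⟨α, hα, rfl⟩ := Finset.mem_image.mp hp
    refine h.2 _ ?_ hne
    simpa [monCoeff, c] using PowerSeries.coeff_order (MvPolynomial.mem_support_iff.mp hα)
  · have h0 : MvPolynomial.coeff p.tail f ≠ 0 := fun h => hp (by simp [monCoeff, h])
    obtain ⟨k, hk⟩ := Nat.exists_eq_add_of_le
      (ENat.toNat_le_of_le_natCast (PowerSeries.order_le (p 0) hp))
    have hpk : p = c p.tail + Finsupp.single 0 k := by
      ext i
      refine Fin.cases ?_ (fun j => ?_) i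
      · simp [c, hk.symm]
      · simp [c, Finsupp.tail_apply]
    have hgt := ho'.gt_add_single (c p.tail) k
    rw [← hpk] at hgt
    by_cases hcm : c p.tail = m
    · rw [hcm] at hgt
      exact hgt.resolve_left hne
    · have hmc := hs _ (Finset.mem_erase.mpr
        ⟨hcm, Finset.mem_image_of_mem c (MvPolynomial.mem_support_iff.mpr h0)⟩)
      rcases hgt with hgt | hgt
      · rwa [hgt]
      · exact o'.gt_trans hmc hgt

/-- An inclusion of leading ideals holds for all orderings that agree with `o` on a suitable finite
set of comparisons. -/
theorem exists_finset_leadingIdeal_le [IsNoetherianRing R] (ho : o.IsTLocal)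
    (I : Ideal (MixedRing n R)) :
    ∃ s : Finset (Mon n × Mon n), (∀ p ∈ s, o.gt p.1 p.2) ∧
      ∀ o' : MonomialOrdering n, o'.IsTLocal → (∀ p ∈ s, o'.gt p.1 p.2) →
        o.leadingIdeal I ≤ o'.leadingIdeal I := by
  classical
  obtain ⟨G, hG, hspan⟩ := (Submodule.fg_span_iff_fg_span_finset_subset
    (R := MvPolynomial (Fin (n + 1)) R) (o.leadingTerm '' (I : Set (MixedRing n R)))).mp
    (IsNoetherian.noetherian _)
  have key : ∀ g ∈ G, ∃ s : Finset (Mon n × Mon n), (∀ p ∈ s, o.gt p.1 p.2) ∧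
      ∀ o' : MonomialOrdering n, o'.IsTLocal → (∀ p ∈ s, o'.gt p.1 p.2) →
        g ∈ o'.leadingIdeal I := by
    intro g hg
    obtain ⟨f, hf, rfl⟩ := hG hg
    by_cases hf0 : f = 0
    · refine ⟨∅, by simp, fun o' _ _ => ?_⟩
      rw [hf0, leadingTerm_zero]
      exact Ideal.zero_mem _
    obtain ⟨m, hm⟩ := o.exists_isLeadingMonomial ho hf0
    obtain ⟨s, hs, hs'⟩ := exists_finset_isLeadingMonomial hm
    refine ⟨s.image fun p => (m, p), by simpa using hs, fun o' ho' h => ?_⟩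
    have hm' := hs' o' ho' (by simpa using h)
    rw [hm.leadingTerm_eq, ← hm'.leadingTerm_eq]
    exact Ideal.subset_span ⟨f, hf, rfl⟩
  choose! s hs hs' using key
  refine ⟨G.biUnion s, fun p hp => ?_, fun o' ho' h => ?_⟩
  · obtain ⟨g, hg, hp⟩ := Finset.mem_biUnion.mp hp
    exact hs g hg p hp
  · rw [leadingIdeal, Ideal.span, hspan, Submodule.span_le]
    exact fun g hg => hs' g hg o' ho' fun p hp => h p (Finset.mem_biUnion.mpr ⟨g, hg, hp⟩)

/-! ### The compact space of `t`-local orderings -/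

/-- The comparison tables of the `t`-local monomial orderings, as a subset of the Cantor space. -/
def tLocalTables (n : ℕ) : Set (Mon n × Mon n → Bool) :=
  {χ | (∀ a, χ (a, a) = false) ∧ (∀ a b c, χ (a, b) = true → χ (b, c) = true → χ (a, c) = true) ∧
    (∀ a b, a ≠ b → χ (a, b) = true ∨ χ (b, a) = true) ∧
    (∀ a b c, χ (a, b) = true → χ (a + c, b + c) = true) ∧ χ (0, Finsupp.single 0 1) = true}

/-- Each axiom is an intersection of conditions on finitely many entries of the table, and such
conditions are clopen. -/
theorem isClosed_tLocalTables (n : ℕ) : IsClosed (tLocalTables n) := by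
  have hc : ∀ (p : Mon n × Mon n) (b : Bool), IsClopen {χ : Mon n × Mon n → Bool | χ p = b} :=
    fun p b => (isClopen_discrete {b}).preimage (continuous_apply p)
  have himp : ∀ {p q : (Mon n × Mon n → Bool) → Prop}, IsClopen {χ | p χ} → IsClosed {χ | q χ} →
      IsClosed {χ | p χ → q χ} := fun hp hq => isClosed_imp hp.isOpen hq
  simp only [tLocalTables, Set.ofPred_and, Set.ofPred_forall]
  refine IsClosed.inter ?_ (IsClosed.inter ?_ (IsClosed.inter ?_ (IsClosed.inter ?_ ?_)))
  · exact isClosed_iInter fun a => (hc _ _).isClosed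
  · exact isClosed_iInter fun a => isClosed_iInter fun b => isClosed_iInter fun c =>
      himp (hc _ _) (himp (hc _ _) (hc _ _).isClosed)
  · exact isClosed_iInter fun a => isClosed_iInter fun b => isClosed_iInter fun _ =>
      (hc _ _).isClosed.union (hc _ _).isClosed
  · exact isClosed_iInter fun a => isClosed_iInter fun b => isClosed_iInter fun c =>
      himp (hc _ _) (hc _ _).isClosed
  · exact (hc _ _).isClosed

/-- The ordering with a given comparison table. -/
def ofTable (χ : tLocalTables n) : MonomialOrdering n where
  gt a b := χ.1 (a, b) = true
  isStrictTotalOrder :=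
    { irrefl := fun a h => by simp [χ.2.1 a] at h
      trans := χ.2.2.1
      trichotomous := fun a b hab hba => by
        by_contra hne
        exact (χ.2.2.2.1 a b hne).elim hab hba }
  gt_add := χ.2.2.2.2.1

theorem ofTable_isTLocal (χ : tLocalTables n) : (ofTable χ).IsTLocal := χ.2.2.2.2.2

theorem IsTLocal.exists_ofTable_eq (ho : o.IsTLocal) : ∃ χ : tLocalTables n, ofTable χ = o := by
  classical
  refine ⟨⟨fun p => decide (o.gt p.1 p.2), ?_, ?_, ?_, ?_, ?_⟩, ?_⟩
  · simpa using o.gt_irrefl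
  · simpa using fun a b c => o.gt_trans (a := a) (b := b) (c := c)
  · intro a b hne
    simpa using (o.gt_trichotomy a b).imp_right fun h => h.resolve_left hne
  · simpa using o.gt_add
  · exact decide_eq_true ho
  · cases o
    simp [ofTable]

theorem isLocallyConstant_leadingIdeal_ofTable [IsNoetherianRing R] {I : Ideal (MixedRing n R)}
    (hI : IsXHomogeneous I) :
    IsLocallyConstant fun χ : tLocalTables n => (ofTable χ).leadingIdeal I := by
  rw [IsLocallyConstant.iff_eventually_eq]
  intro χ
  obtain ⟨s, hs, hs'⟩ := exists_finset_leadingIdeal_le (ofTable_isTLocal χ) I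
  have hev : ∀ᶠ ψ : tLocalTables n in nhds χ, ∀ p ∈ s, (ofTable ψ).gt p.1 p.2 := by
    rw [Filter.eventually_all_finset]
    intro p hp
    have hopen : IsOpen {ψ : tLocalTables n | ψ.1 p = true} :=
      (isOpen_discrete {b : Bool | b = true}).preimage
        ((continuous_apply (A := fun _ => Bool) p).comp continuous_subtype_val)
    exact hopen.mem_nhds (hs p hp)
  filter_upwards [hev] with ψ hψ
  exact leadingIdeal_eq_of_le (ofTable_isTLocal χ) (ofTable_isTLocal ψ) hI
    (hs' _ (ofTable_isTLocal ψ) hψ)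

end MonomialOrdering

end

theorem proposition2p1 {R : Type*} [CommRing R] [IsNoetherianRing R] (n : ℕ)
    (I : Ideal (MixedRing n R)) (hI : MixedRing.IsXHomogeneous I) :
    Set.Finite {J : Ideal (MvPolynomial (Fin (n + 1)) R) |
      ∃ o : MonomialOrdering n, o.IsTLocal ∧ o.leadingIdeal I = J} := by
  have : CompactSpace (MonomialOrdering.tLocalTables n) :=
    isCompact_iff_compactSpace.mp (MonomialOrdering.isClosed_tLocalTables n).isCompact
  refine (MonomialOrdering.isLocallyConstant_leadingIdeal_ofTable hI).range_finite.subset ?_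
  rintro _ ⟨o, ho, rfl⟩
  obtain ⟨χ, rfl⟩ := ho.exists_ofTable_eq
  exact ⟨χ, rfl⟩
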